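/- Let $f:(0,1)\times\mathbb R\to\mathbb R$ be any function. For $v\in BV(0,1)$ write $Dv = D^a v\,dx + D^s v$ for the Lebesgue decomposition of its derivative measure, $\frac{D^s v}{|D^s v|}$ for the density of $D^s v$ with respect to its total variation, and $v(0^+)$, $v(1^-)$ for its traces at the endpoints. A function $u\in BV(0,1)$ is a bounded variation solution of the periodic problem $$-\left(\frac{u'}{\sqrt{1+(u')^2}}\right)' = f(x,u)\ \text{ in } (0,1),\qquad u(0)=u(1),\quad u'(0)=u'(1), \tag{P}$$ if $f(\cdot,u(\cdot))\in L^1(0,1)$ and $$\int_0^1\frac{D^a u\, D^a\phi}{\sqrt{1+(D^a u)^2}}\,dx+\int_0^1\frac{D^s u}{|D^s u|}\,D^s\phi+\operatorname{sgn}\big(u(1^-)-u(0^+)\big)\big(\phi(1^-)-\phi(0^+)\big)=\int_0^1 f(x,u(x))\,\phi(x)\,dx$$ for all $\phi\in BV(0,1)$ such that $|D^s\phi|$ is absolutely continuous with respect to $|D^s u|$ and such that $\phi(0^+)=\phi(1^-)$ if $u(0^+)=u(1^-)$; here $\operatorname{sgn}(0)=0$. **Theorem 4.5.** Let $u$ be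 a bounded variation solution of (P). Assume the following. 1. There is $z\in(0,1)$ such that $f(x,u(x))\ge 0$ for almost all $x\in(0,z)$ and $f(x,u(x))\le 0$ for almost all $x\in(z,1)$. 2. Either there are $\delta\in(0,z]$ and $\mu\in L^1(z-\delta,z)$ such that $f(x,u(x))\le\mu(x)$ for almost all $x\in(z-\delta,z)$, $M(x):=\int_x^z\mu(t)\,dt>0$ for all $x\in[z-\delta,z)$, and $\int_{z-\delta}^z\frac{dx}{\sqrt{M(x)}}=+\infty$; or there are $\delta\in(0,1-z]$ and $\nu\in L^1(z,z+\delta)$ such that $f(x,u(x))\ge\nu(x)$ for almost all $x\in(z,z+\delta)$, $N(x):=\int_z^x\nu(t)\,dt<0$ for all $x\in(z,z+\delta]$, and $\int_z^{z+\delta}\frac{dx}{\sqrt{-N(x)}}=+\infty$. 3. Either there are $\delta\in(0,1]$ and $\mu\in L^1(0,\delta)$ such that $f(x,u(x))\le\mu(x)$ for almost all $x\in(0,\delta)$, $M(x):=\int_0^x\mu(t)\,dt>0$ for all $x\in(0,\delta]$, and $\int_0^\delta\frac{dx}{\sqrt{M(x)}}=+\infty$; or there are $\delta\in(0,1]$ and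 $\nu\in L^1(1-\delta,1)$ such that $f(x,u(x))\ge\nu(x)$ for almost all $x\in(1-\delta,1)$, $N(x):=\int_x^1\nu(t)\,dt<0$ for all $x\in[1-\delta,1)$, and $\int_{1-\delta}^1\frac{dx}{\sqrt{-N(x)}}=+\infty$. Then $u\in W^{2,1}(0,1)$, and (the $C^1[0,1]$ representative of) $u$ satisfies $-\left(\frac{u'}{\sqrt{1+(u')^2}}\right)'=f(x,u)$ almost everywhere in $(0,1)$ together with $u(0)=u(1)$ and $u'(0)=u'(1)$. -/

import Mathlib

open MeasureTheory Set Filter Topology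
open scoped ContDiff

namespace PeriodicCurvature

noncomputable section

/-- `ν` is the distributional derivative `Du` of `u` on `(0,1)`: `u ∈ L¹(0,1)`, `ν` is a finite
signed Borel measure concentrated on `(0,1)`, and `∫ u φ' dx = - ∫ φ dν` for all
`φ ∈ C_c^∞(0,1)`. A function `u` belongs to `BV(0,1)` if and only if such a `ν` exists; the
measure `ν` is then unique. Only the values of `u` almost everywhere in `(0,1)` matter. -/
structure HasDerivMeasure (u : ℝ → ℝ) (ν : SignedMeasure ℝ) : Prop where
  integrable : IntegrableOn u (Ioo 0 1)
  concentrated : ν.restrict (Ioo 0 1) = ν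
  integral_eq : ∀ φ : ℝ → ℝ, ContDiff ℝ ∞ φ → HasCompactSupport φ → tsupport φ ⊆ Ioo 0 1 →
    ∫ x in Ioo (0 : ℝ) 1, u x * deriv φ x = - ∫ᵛ x, φ x ∂<•ν

/-- The density `Dᵃu` of the absolutely continuous part of `ν = Du`. -/
def acDensity (ν : SignedMeasure ℝ) : ℝ → ℝ := ν.rnDeriv volume

/-- The singular part `Dˢu` of `ν = Du` with respect to Lebesgue measure. -/
def singPart (ν : SignedMeasure ℝ) : SignedMeasure ℝ := ν.singularPart volume

/-- The density `σ / |σ|` of a signed measure `σ` with respect to its total variation `|σ|`. -/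
def polarDensity (σ : SignedMeasure ℝ) : ℝ → ℝ := σ.rnDeriv σ.totalVariation

/-- `a` is the right trace `u(x₀⁺)`: the (essential) limit of `u` at `x₀` from the right. -/
def IsRightTrace (u : ℝ → ℝ) (x₀ a : ℝ) : Prop :=
  Tendsto u (𝓝[>] x₀ ⊓ ae volume) (𝓝 a)

/-- `a` is the left trace `u(x₀⁻)`: the (essential) limit of `u` at `x₀` from the left. -/
def IsLeftTrace (u : ℝ → ℝ) (x₀ a : ℝ) : Prop :=
  Tendsto u (𝓝[<] x₀ ⊓ ae volume) (𝓝 a)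

/-- `u` is a bounded variation solution of the periodic problem
`-(u' / √(1 + u'²))' = f(x, u)` in `(0,1)`, `u(0) = u(1)`, `u'(0) = u'(1)`.
Here `ν = Du`, `u₀ = u(0⁺)`, `u₁ = u(1⁻)`, and, for the test function `φ ∈ BV(0,1)`, `κ = Dφ`,
`φ₀ = φ(0⁺)`, `φ₁ = φ(1⁻)`; all these are uniquely determined by `u` and `φ`. -/
def IsPeriodicBVSolution (f : ℝ → ℝ → ℝ) (u : ℝ → ℝ) : Prop :=
  IntegrableOn (fun x => f x (u x)) (Ioo 0 1) ∧
  ∃ (ν : SignedMeasure ℝ) (u₀ u₁ : ℝ),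
    HasDerivMeasure u ν ∧ IsRightTrace u 0 u₀ ∧ IsLeftTrace u 1 u₁ ∧
    ∀ (φ : ℝ → ℝ) (κ : SignedMeasure ℝ) (φ₀ φ₁ : ℝ),
      HasDerivMeasure φ κ → IsRightTrace φ 0 φ₀ → IsLeftTrace φ 1 φ₁ →
      (singPart κ).totalVariation ≪ (singPart ν).totalVariation →
      (u₀ = u₁ → φ₀ = φ₁) →
      (∫ x in Ioo (0 : ℝ) 1, acDensity ν x * acDensity κ x / √(1 + acDensity ν x ^ 2))
        + (∫ᵛ x, polarDensity (singPart ν) x ∂<•(singPart κ))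
        + Real.sign (u₁ - u₀) * (φ₁ - φ₀)
        = ∫ x in Ioo (0 : ℝ) 1, f x (u x) * φ x

/-- Decay to the right of `a`: near `a` in `(a, a + δ) ⊆ (0,1)` one has `g ≤ μ` for some
integrable `μ` whose primitive `M(x) = ∫ₐˣ μ` is positive on `(a, a + δ]` and satisfies
`∫ 1 / √M = +∞` on `(a, a + δ)`. The lower bound `g ≥ ν` with `N(x) = ∫ₐˣ ν < 0` and
`∫ 1 / √(-N) = +∞` is the same condition for `-g`, with `μ = -ν`. -/
def DecayRight (g : ℝ → ℝ) (a : ℝ) : Prop :=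
  ∃ δ : ℝ, 0 < δ ∧ a + δ ≤ 1 ∧ ∃ μ : ℝ → ℝ,
    IntegrableOn μ (Ioo a (a + δ)) ∧
    (∀ᵐ x ∂(volume.restrict (Ioo a (a + δ))), g x ≤ μ x) ∧
    (∀ x ∈ Ioc a (a + δ), 0 < ∫ t in a..x, μ t) ∧
    ∫⁻ x in Ioo a (a + δ), ENNReal.ofReal (1 / √(∫ t in a..x, μ t)) = ⊤

/-- Decay to the left of `b`: near `b` in `(b - δ, b) ⊆ (0,1)` one has `g ≤ μ` for some
integrable `μ` such that `M(x) = ∫ₓᵇ μ` is positive on `[b - δ, b)` and satisfies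
`∫ 1 / √M = +∞` on `(b - δ, b)`. The lower bound `g ≥ ν` with `N(x) = ∫ₓᵇ ν < 0` and
`∫ 1 / √(-N) = +∞` is the same condition for `-g`, with `μ = -ν`. -/
def DecayLeft (g : ℝ → ℝ) (b : ℝ) : Prop :=
  ∃ δ : ℝ, 0 < δ ∧ 0 ≤ b - δ ∧ ∃ μ : ℝ → ℝ,
    IntegrableOn μ (Ioo (b - δ) b) ∧
    (∀ᵐ x ∂(volume.restrict (Ioo (b - δ) b)), g x ≤ μ x) ∧
    (∀ x ∈ Ico (b - δ) b, 0 < ∫ t in x..b, μ t) ∧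
    ∫⁻ x in Ioo (b - δ) b, ENNReal.ofReal (1 / √(∫ t in x..b, μ t)) = ⊤

/-- `v` is the weak derivative of `u` on `(0,1)`. -/
def HasWeakDeriv (u v : ℝ → ℝ) : Prop :=
  ∀ φ : ℝ → ℝ, ContDiff ℝ ∞ φ → HasCompactSupport φ → tsupport φ ⊆ Ioo 0 1 →
    ∫ x in Ioo (0 : ℝ) 1, u x * deriv φ x = - ∫ x in Ioo (0 : ℝ) 1, v x * φ x

/-- The Sobolev space `W^{2,1}(0,1)`: `u` and its first two weak derivatives are in `L¹(0,1)`. -/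
def MemW21 (u : ℝ → ℝ) : Prop :=
  IntegrableOn u (Ioo 0 1) ∧
  ∃ v w : ℝ → ℝ, IntegrableOn v (Ioo 0 1) ∧ IntegrableOn w (Ioo 0 1) ∧
    HasWeakDeriv u v ∧ HasWeakDeriv v w

end

end PeriodicCurvature

/-! Write `g = f(·, u)`, `G` for its primitive vanishing at `0`, `a` for the density of `Dᵃu`, and
`T = a / √(1 + a²)` for the flux.

Smooth compactly supported test functions give `T' = -g`, so `T = C - G` almost everywhere, and the
constant `1` gives `G(1) = 0`. If the end traces differ, `φ(x) = x` is admissible and forces `sgn(u₁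
- u₀) = -C` (`WeakEquation.exists_flux_eq`).

Everything rests on the strict bound `|C - G| < 1` (`abs_sub_primitive_lt_one`). By the sign of `g`,
`G` rises from `0` to `G(z)` and falls back to `0`, so `C - G` is largest at the end points and
smallest at `z`; only `C = 1` and `C - G(z) = -1` need excluding. In either case `1 - |T|` is
dominated near that point by the primitive `M` of the decay condition. Since `1 - |T|` is comparable
to `1 / (1 + a²)`, this yields `1 / √M ≤ 2 (1 + |a|)`, and integrability of `a` contradicts `∫ 1 /
√M = ∞`.

The bound excludes `|C| = 1`, so the traces agree. Testing with `u` itself and applying Fubini to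
the right-hand side then gives `|Dˢu|(0,1) = ∫ (C - G) dDˢu`, which forces `Dˢu = 0`
(`WeakEquation.singPart_eq_zero`). Hence `u` is a primitive of the inverse flux of `C - G`. The
values of `C - G` on `[0,1]` fill a compact subset of `(-1,1)`, where the inverse flux is Lipschitz,
so `u'` is absolutely continuous; `G(0) = G(1)` makes it periodic. -/

namespace PeriodicCurvature

/-! ### Integration against signed measures and the polar density. -/

section SignedMeasure

variable {α : Type*} [MeasurableSpace α]

theorem integral_signedMeasure_eq_sub (σ : SignedMeasure α) (φ : α → ℝ)
    (hφ : Integrable φ σ.totalVariation) :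
    ∫ᵛ x, φ x ∂<•σ = ∫ x, φ x ∂σ.toJordanDecomposition.posPart
      - ∫ x, φ x ∂σ.toJordanDecomposition.negPart := by
  have hp : Integrable φ σ.toJordanDecomposition.posPart :=
    hφ.mono_measure (Measure.le_add_right le_rfl)
  have hn : Integrable φ σ.toJordanDecomposition.negPart :=
    hφ.mono_measure (Measure.le_add_left le_rfl)
  conv_lhs => rw [← σ.toSignedMeasure_toJordanDecomposition, JordanDecomposition.toSignedMeasure]
  rw [VectorMeasure.integral_sub_vectorMeasure]
  · simp
  · simpa [VectorMeasure.Integrable] using hp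
  · simpa [VectorMeasure.Integrable] using hn

theorem integral_withDensityᵥ (μ : Measure α) (h φ : α → ℝ)
    (hh : Integrable h μ) (hφ : Measurable φ) {K : ℝ} (hK : ∀ x, |φ x| ≤ K) :
    ∫ᵛ x, φ x ∂<•(μ.withDensityᵥ h) = ∫ x, φ x * h x ∂μ := by
  have key : ∀ h : α → ℝ, Integrable h μ → (0 ≤ᵐ[μ] h) →
      ∫ x, φ x ∂(μ.withDensity fun x => ENNReal.ofReal (h x)) = ∫ x, φ x * h x ∂μ := by
    intro h hh h0
    rw [integral_withDensity_eq_integral_toReal_smul₀ hh.1.aemeasurable.ennreal_ofReal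
      (by simp)]
    refine integral_congr_ae ?_
    filter_upwards [h0] with x hx
    simp only [Pi.zero_apply] at hx
    simp [hx, mul_comm]
  have e1 : (fun x => ENNReal.ofReal (h x)) = fun x => ENNReal.ofReal (max (h x) 0) := by
    ext x; simp
  have e2 : (fun x => ENNReal.ofReal (-h x)) = fun x => ENNReal.ofReal (max (-h x) 0) := by
    ext x; simp
  have := isFiniteMeasure_withDensity_ofReal hh.2
  have := isFiniteMeasure_withDensity_ofReal hh.neg.2
  have := isFiniteMeasure_withDensity_ofReal (f := fun x => - h x) hh.neg.2
  have hb : ∀ m : Measure α, IsFiniteMeasure m → Integrable φ m := fun m _ =>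
    Integrable.of_bound hφ.aestronglyMeasurable K (.of_forall hK)
  rw [withDensityᵥ_eq_withDensity_pos_part_sub_withDensity_neg_part hh,
    VectorMeasure.integral_sub_vectorMeasure]
  · rw [VectorMeasure.integral_toSignedMeasure, VectorMeasure.integral_toSignedMeasure]
    simp only [e1, e2]
    rw [key _ hh.pos_part (.of_forall fun x => le_max_right _ _),
      key _ hh.neg_part (.of_forall fun x => le_max_right _ _), ← integral_sub]
    · congr 1; ext x
      rw [← mul_sub]
      congr 1
      rcases le_total 0 (h x) with h | h <;> simp [h]
    · exact hh.pos_part.bdd_mul hφ.aestronglyMeasurable (.of_forall hK)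
    · exact hh.neg_part.bdd_mul hφ.aestronglyMeasurable (.of_forall hK)
  · simpa [VectorMeasure.Integrable] using hb _ inferInstance
  · simpa [VectorMeasure.Integrable] using hb _ inferInstance

/-- A signed measure vanishes if its polar density has the same integral as a function with
values in `(-1, 1)`. -/
theorem eq_zero_of_integral_rnDeriv_eq (σ : SignedMeasure α) (H : α → ℝ) (hH : Measurable H)
    (hH1 : ∀ x, |H x| < 1)
    (h : ∫ᵛ x, σ.rnDeriv σ.totalVariation x ∂<•σ = ∫ᵛ x, H x ∂<•σ) : σ = 0 := by
  set τ := σ.totalVariation with hτ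
  set p := σ.rnDeriv τ with hp
  have hpi : Integrable p τ := SignedMeasure.integrable_rnDeriv _ _
  have hpm : Measurable p := SignedMeasure.measurable_rnDeriv _ _
  have hσ : τ.withDensityᵥ p = σ := by
    refine (SignedMeasure.absolutelyContinuous_iff_withDensityᵥ_rnDeriv_eq σ τ).1 ?_
    rw [SignedMeasure.absolutelyContinuous_ennreal_iff,
      VectorMeasure.ennrealToMeasure_toENNRealVectorMeasure]
  -- The variation of `p τ` is `|p| τ`, and it is also `τ`; hence `|p| = 1` almost everywhere.
  have hvar : τ.withDensity (fun x => ‖p x‖ₑ) = τ.withDensity 1 := by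
    rw [← Measure.variation_withDensityᵥ hpi, hσ, withDensity_one, hτ,
      SignedMeasure.totalVariation_eq_variation]
  have hp1 : ∀ᵐ x ∂τ, |p x| = 1 := by
    have := (withDensity_eq_iff_of_sigmaFinite hpm.enorm.aemeasurable
      aemeasurable_const).1 hvar
    filter_upwards [this] with x hx
    have : ‖p x‖ₑ.toReal = 1 := by rw [hx]; simp
    simpa using this
  -- `integral_withDensityᵥ` needs a bound at every point, while `|p| = 1` holds only almost
  -- everywhere; the truncation supplies it.
  set q : α → ℝ := fun x => max (-1) (min 1 (p x)) with hq
  have hqp : ∀ᵐ x ∂τ, q x = p x := by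
    filter_upwards [hp1] with x hx
    have := abs_le.1 hx.le
    simp [hq, this.1, this.2]
  have hqm : Measurable q := measurable_const.max (measurable_const.min hpm)
  have e1 : ∫ᵛ x, p x ∂<•σ = ∫ x, q x * p x ∂τ := by
    rw [← integral_withDensityᵥ τ p q hpi hqm (K := 1), hσ]
    · refine VectorMeasure.integral_congr_ae ?_
      rw [← SignedMeasure.totalVariation_eq_variation]
      exact hqp.mono fun x hx => hx.symm
    · intro x
      rw [abs_le]
      exact ⟨le_max_left _ _, max_le (by norm_num) (min_le_left _ _)⟩
  have e2 : ∫ᵛ x, H x ∂<•σ = ∫ x, H x * p x ∂τ := by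
    rw [← integral_withDensityᵥ τ p H hpi hH (K := 1) (fun x => (hH1 x).le), hσ]
  rw [e1, e2] at h
  have i1 : Integrable (fun x => q x * p x) τ := by
    refine (integrable_const (1 : ℝ)).congr ?_
    filter_upwards [hp1, hqp] with x hx hx'
    rw [hx', ← abs_mul_abs_self, hx, one_mul]
  have i2 : Integrable (fun x => H x * p x) τ :=
    hpi.bdd_mul hH.aestronglyMeasurable (.of_forall fun x => (hH1 x).le)
  have h0 : ∫ x, (q x * p x - H x * p x) ∂τ = 0 := by rw [integral_sub i1 i2, h, sub_self]
  -- Here `q p = p² = 1 > H p`: a strictly positive integrand with zero integral forces `τ = 0`.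
  have hpos : ∀ᵐ x ∂τ, 0 < q x * p x - H x * p x := by
    filter_upwards [hp1, hqp] with x hx hx'
    rw [hx', ← abs_mul_abs_self (p x), hx, one_mul, sub_pos]
    calc H x * p x ≤ |H x * p x| := le_abs_self _
      _ < 1 := by rw [abs_mul, hx, mul_one]; exact hH1 x
  have hae := (integral_eq_zero_iff_of_nonneg_ae (hpos.mono fun x hx => hx.le) (i1.sub i2)).1 h0
  have : ∀ᵐ x ∂τ, False := by
    filter_upwards [hae, hpos] with x h1 h2
    simp only [Pi.zero_apply] at h1
    exact h2.ne' h1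
  have hτ0 : τ = 0 := by simpa using this
  rw [← hσ, hτ0]
  ext s hs
  simp [withDensityᵥ_apply, hs]

end SignedMeasure

/-! ### Fubini for distribution functions. -/

section Fubini

theorem integrable_indicator_le (q : ℝ → ℝ) (hq : Integrable q) (μ : Measure ℝ)
    [IsFiniteMeasure μ] :
    Integrable (fun z : ℝ × ℝ => {z : ℝ × ℝ | z.2 ≤ z.1}.indicator (fun z => q z.1) z)
      (volume.prod μ) :=
  (hq.comp_fst μ).indicator (measurableSet_le measurable_snd measurable_fst)

theorem integrable_setIntegral_Ici (q : ℝ → ℝ) (hq : Integrable q) (μ : Measure ℝ)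
    [IsFiniteMeasure μ] : Integrable (fun t => ∫ x in Ici t, q x) μ := by
  refine ((integrable_indicator_le q hq μ).swap.integral_prod_left).congr (.of_forall fun t => ?_)
  simp only [Function.comp_def, Prod.swap]
  rw [← integral_indicator measurableSet_Ici]
  rfl

theorem integral_mul_measureReal_Iic (q : ℝ → ℝ) (hq : Integrable q) (μ : Measure ℝ)
    [IsFiniteMeasure μ] :
    ∫ x, q x * μ.real (Iic x) = ∫ t, (∫ x in Ici t, q x) ∂μ := by
  have := integral_integral_swap (integrable_indicator_le q hq μ)
    (f := fun x t => {z : ℝ × ℝ | z.2 ≤ z.1}.indicator (fun z => q z.1) (x, t))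
  have e1 : ∀ x, ∫ t, {z : ℝ × ℝ | z.2 ≤ z.1}.indicator (fun z => q z.1) (x, t) ∂μ
      = q x * μ.real (Iic x) := by
    intro x
    have : (fun t => {z : ℝ × ℝ | z.2 ≤ z.1}.indicator (fun z => q z.1) (x, t))
      = (Iic x).indicator fun _ => q x := by ext t; simp [indicator]
    rw [this, integral_indicator measurableSet_Iic]
    simp [mul_comm]
  have e2 : ∀ t, ∫ x, {z : ℝ × ℝ | z.2 ≤ z.1}.indicator (fun z => q z.1) (x, t)
      = ∫ x in Ici t, q x := by
    intro t
    rw [← integral_indicator measurableSet_Ici]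
    rfl
  simpa only [e1, e2] using this

theorem integrable_mul_measureReal_Iic (q : ℝ → ℝ) (hq : Integrable q) (μ : Measure ℝ)
    [IsFiniteMeasure μ] : Integrable fun x => q x * μ.real (Iic x) := by
  refine hq.mul_bdd (c := μ.real univ) (Monotone.measurable fun x y h => ?_).aestronglyMeasurable
    (.of_forall fun x => ?_)
  · exact measureReal_mono (Iic_subset_Iic.2 h)
  · rw [Real.norm_eq_abs, abs_of_nonneg measureReal_nonneg]
    exact measureReal_mono (subset_univ _)

/-- Fubini on `{t ≤ x}`, applied to both Jordan parts. It serves as integration by parts twice: with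
`q = ψ'` to represent BV functions, and with `q = g` to test the equation with `u`. -/
theorem integral_mul_signedMeasure_Iic (q : ℝ → ℝ) (hq : Integrable q) (ν : SignedMeasure ℝ) :
    ∫ x, q x * ν (Iic x) = ∫ᵛ t, (∫ x in Ici t, q x) ∂<•ν := by
  rw [integral_signedMeasure_eq_sub _ _ (integrable_setIntegral_Ici q hq _),
    ← integral_mul_measureReal_Iic q hq, ← integral_mul_measureReal_Iic q hq, ← integral_sub
      (integrable_mul_measureReal_Iic q hq _) (integrable_mul_measureReal_Iic q hq _)]
  simp only [← mul_sub, ν.apply_eq_posPart_real_sub_negPart_real measurableSet_Iic]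

theorem integrable_mul_signedMeasure_Iic (q : ℝ → ℝ) (hq : Integrable q) (ν : SignedMeasure ℝ) :
    Integrable fun x => q x * ν (Iic x) := by
  simp only [ν.apply_eq_posPart_real_sub_negPart_real measurableSet_Iic, mul_sub]
  exact (integrable_mul_measureReal_Iic q hq _).sub (integrable_mul_measureReal_Iic q hq _)

end Fubini

/-! ### Compactly supported test functions and the du Bois-Reymond lemma. -/

section Cutoff

theorem apply_eq_zero_of_tsupport_subset {ψ : ℝ → ℝ} (hψ : tsupport ψ ⊆ Ioo 0 1) {x : ℝ}
    (hx : x ∉ Ioo (0 : ℝ) 1) : ψ x = 0 :=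
  image_eq_zero_of_notMem_tsupport fun h => hx (hψ h)

theorem setIntegral_Ioo_eq_intervalIntegral (h : ℝ → ℝ) :
    ∫ x in Ioo (0 : ℝ) 1, h x = ∫ x in (0 : ℝ)..1, h x := by
  rw [intervalIntegral.integral_of_le zero_le_one, integral_Ioc_eq_integral_Ioo]

theorem exists_Icc_of_isCompact_subset_Ioo {K : Set ℝ} (hK : IsCompact K) {a b : ℝ} (hab : a < b)
    (h : K ⊆ Ioo a b) : ∃ α β, a < α ∧ β < b ∧ K ⊆ Icc α β := by
  rcases K.eq_empty_or_nonempty with rfl | hne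
  -- For empty `K` the reversed interval satisfies both strict inequalities.
  · exact ⟨b, a, hab, hab, empty_subset _⟩
  · exact ⟨sInf K, sSup K, (h (hK.sInf_mem hne)).1, (h (hK.sSup_mem hne)).2,
      fun x hx => ⟨csInf_le hK.bddBelow hx, le_csSup hK.bddAbove hx⟩⟩

/-- A test function on `(0,1)` with zero mean is the derivative of a test function. -/
theorem exists_primitive_of_integral_eq_zero (h : ℝ → ℝ) (hc : ContDiff ℝ ∞ h)
    (hs : HasCompactSupport h) (ht : tsupport h ⊆ Ioo 0 1) (h0 : ∫ x, h x = 0) :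
    ∃ φ : ℝ → ℝ, ContDiff ℝ ∞ φ ∧ HasCompactSupport φ ∧ tsupport φ ⊆ Ioo 0 1 ∧ deriv φ = h := by
  obtain ⟨α, β, hα, hβ, hK⟩ := exists_Icc_of_isCompact_subset_Ioo hs zero_lt_one ht
  have hz : ∀ x, x ∉ Icc α β → h x = 0 := fun x hx =>
    image_eq_zero_of_notMem_tsupport fun h => hx (hK h)
  have hd : ∀ x, HasDerivAt (fun x => ∫ t in (0 : ℝ)..x, h t) (h x) x := fun x =>
    intervalIntegral.integral_hasDerivAt_right (hc.continuous.intervalIntegrable _ _)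
      hc.continuous.stronglyMeasurable.stronglyMeasurableAtFilter hc.continuous.continuousAt
  have hderiv : deriv (fun x => ∫ t in (0 : ℝ)..x, h t) = h := funext fun x => (hd x).deriv
  have hzero : ∀ x, x ∉ Icc α β → ∫ t in (0 : ℝ)..x, h t = 0 := by
    intro x hx
    rcases lt_or_ge x α with hxα | hxα
    · have : ∫ t in (0 : ℝ)..x, h t = ∫ t in (0 : ℝ)..x, (0 : ℝ) := by
        refine intervalIntegral.integral_congr fun t ht => hz t fun ht' => ?_
        have := ht.2
        exact absurd (ht'.1.trans this) (not_le.2 (max_lt hα hxα))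
      simpa using this
    · have hxβ : β < x := by by_contra hcon; exact hx ⟨hxα, not_lt.1 hcon⟩
      -- To the right of the support the primitive equals the full integral, which is zero.
      rw [intervalIntegral.integral_eq_integral_of_support_subset, h0]
      intro t ht
      by_contra hcon
      refine ht (hz t fun ht' => hcon ⟨hα.trans_le ht'.1, (ht'.2.trans hxβ.le)⟩)
  have hts : tsupport (fun x => ∫ t in (0 : ℝ)..x, h t) ⊆ Icc α β :=
    closure_minimal (fun x hx => by by_contra hcon; exact hx (hzero x hcon)) isClosed_Icc
  refine ⟨_, ?_, isCompact_Icc.of_isClosed_subset (isClosed_tsupport _) hts,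
    hts.trans fun x hx => ⟨hα.trans_le hx.1, hx.2.trans_lt hβ⟩, hderiv⟩
  rw [contDiff_infty_iff_deriv, hderiv]
  exact ⟨fun x => (hd x).differentiableAt, hc⟩

/-- The du Bois-Reymond lemma on `(0,1)`. -/
theorem exists_ae_eq_const_of_integral_mul_deriv_eq_zero (w : ℝ → ℝ)
    (hw : IntegrableOn w (Ioo 0 1))
    (h : ∀ φ : ℝ → ℝ, ContDiff ℝ ∞ φ → HasCompactSupport φ → tsupport φ ⊆ Ioo 0 1 →
      ∫ x in Ioo (0 : ℝ) 1, w x * deriv φ x = 0) :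
    ∃ c, ∀ᵐ x ∂(volume.restrict (Ioo (0 : ℝ) 1)), w x = c := by
  -- Any test function `η` of mass one would do; the constant is then `∫ w η`. This one is supported
  -- in `[1/4, 3/4]`.
  let b : ContDiffBump (1 / 2 : ℝ) := ⟨1 / 8, 1 / 4, by norm_num, by norm_num⟩
  set η : ℝ → ℝ := b.normed volume with hη
  have hηc : ContDiff ℝ ∞ η := b.contDiff_normed
  have hηs : HasCompactSupport η := b.hasCompactSupport_normed
  have hηt : tsupport η ⊆ Ioo 0 1 := by
    rw [hη, b.tsupport_normed_eq, Real.closedBall_eq_Icc]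
    exact Icc_subset_Ioo (by norm_num [b]) (by norm_num [b])
  have hη1 : ∫ x, η x = 1 := b.integral_normed
  set c := ∫ x in Ioo (0 : ℝ) 1, w x * η x
  have hmul : ∀ ψ : ℝ → ℝ, Continuous ψ → HasCompactSupport ψ →
      IntegrableOn (fun x => w x * ψ x) (Ioo 0 1) := fun ψ h1 h2 => by
    obtain ⟨C, hC⟩ := h2.exists_bound_of_continuous h1
    exact hw.mul_bdd h1.aestronglyMeasurable (.of_forall hC)
  refine ⟨c, (ae_restrict_iff' measurableSet_Ioo).2 ?_⟩
  have := isOpen_Ioo.ae_eq_zero_of_integral_contDiff_smul_eq_zero (U := Ioo (0 : ℝ) 1)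
    (f := fun x => w x - c) (μ := volume) ?_ ?_
  · filter_upwards [this] with x hx hx'
    exact sub_eq_zero.1 (hx hx')
  · exact (hw.sub (integrableOn_const (by simp))).locallyIntegrableOn
  · intro ψ hψ hψs hψt
    set m := ∫ x, ψ x with hm
    have hmi : ∫ x in Ioo (0 : ℝ) 1, ψ x = m :=
      setIntegral_eq_integral_of_forall_compl_eq_zero fun x hx =>
        apply_eq_zero_of_tsupport_subset hψt hx
    have hψi : Integrable ψ := hψ.continuous.integrable_of_hasCompactSupport hψs
    have hηi : Integrable η := hηc.continuous.integrable_of_hasCompactSupport hηs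
    have hms : HasCompactSupport fun x => m * η x := hηs.mul_left
    -- Subtracting `m η` removes the mean of `ψ`, so the difference is some `φ'` and the hypothesis
    -- gives `∫ w ψ = m ∫ w η`.
    obtain ⟨φ, h1, h2, h3, h4⟩ := exists_primitive_of_integral_eq_zero (fun x => ψ x - m * η x)
      (hψ.sub (contDiff_const.mul hηc)) (hψs.sub hms)
      ((tsupport_sub ψ fun x => m * η x).trans (union_subset hψt
        ((closure_mono (Function.support_mul_subset_right (fun _ => m) η)).trans hηt)))
      (by rw [integral_sub hψi (hηi.const_mul m), integral_const_mul, hη1, mul_one, sub_self])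
    have h5 := h φ h1 h2 h3
    simp only [h4] at h5
    have e : (fun x => w x * (ψ x - m * η x)) = fun x => w x * ψ x - m * (w x * η x) := by
      ext x; ring
    rw [e, integral_sub (hmul ψ hψ.continuous hψs)
      ((hmul η hηc.continuous hηs).const_mul m), integral_const_mul] at h5
    rw [← setIntegral_eq_integral_of_forall_compl_eq_zero (s := Ioo (0 : ℝ) 1) (fun x hx => by
        simp [apply_eq_zero_of_tsupport_subset hψt hx])]
    have e' : (fun x => ψ x • (w x - c)) = fun x => w x * ψ x - c * ψ x := by
      ext x; simp only [smul_eq_mul]; ring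
    rw [e', integral_sub (hmul ψ hψ.continuous hψs) (hψi.integrableOn.const_mul c),
      integral_const_mul, hmi]
    linarith

end Cutoff

/-! ### Smooth functions as BV test functions. -/

section SmoothTest

theorem continuous_integrableOn_Ioo {w : ℝ → ℝ} (hw : Continuous w) (a b : ℝ) :
    IntegrableOn w (Ioo a b) :=
  (hw.integrableOn_Icc).mono_set Ioo_subset_Icc_self

theorem integrable_indicator_deriv {φ : ℝ → ℝ} (hφ : ContDiff ℝ 1 φ) :
    Integrable ((Ioo (0 : ℝ) 1).indicator (deriv φ)) :=
  (integrable_indicator_iff measurableSet_Ioo).2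
    (continuous_integrableOn_Ioo (hφ.continuous_deriv le_rfl) _ _)

theorem hasDerivMeasure_of_contDiff {φ : ℝ → ℝ} (hφ : ContDiff ℝ 1 φ) :
    HasDerivMeasure φ (volume.withDensityᵥ ((Ioo (0 : ℝ) 1).indicator (deriv φ))) := by
  have hi := integrable_indicator_deriv hφ
  refine ⟨continuous_integrableOn_Ioo hφ.continuous _ _, ?_, ?_⟩
  · ext s hs
    rw [VectorMeasure.restrict_apply _ measurableSet_Ioo hs,
      withDensityᵥ_apply hi (hs.inter measurableSet_Ioo), withDensityᵥ_apply hi hs,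
      setIntegral_indicator measurableSet_Ioo, setIntegral_indicator measurableSet_Ioo,
      inter_assoc, inter_self]
  · intro ψ hψ hψs hψt
    obtain ⟨C, hC⟩ := hψs.exists_bound_of_continuous hψ.continuous
    rw [integral_withDensityᵥ volume _ ψ hi hψ.continuous.measurable hC]
    have : (fun x => ψ x * (Ioo (0 : ℝ) 1).indicator (deriv φ) x)
        = (Ioo (0 : ℝ) 1).indicator fun x => deriv φ x * ψ x := by
      ext x; by_cases hx : x ∈ Ioo (0 : ℝ) 1 <;> simp [hx, mul_comm]
    rw [this, integral_indicator measurableSet_Ioo, setIntegral_Ioo_eq_intervalIntegral,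
      setIntegral_Ioo_eq_intervalIntegral,
      intervalIntegral.integral_mul_deriv_eq_deriv_mul (u := φ) (u' := deriv φ) (v := ψ)
        (fun x _ => (hφ.differentiable one_ne_zero x).hasDerivAt)
        (fun x _ => (hψ.differentiable (by simp) x).hasDerivAt)
        ((hφ.continuous_deriv le_rfl).intervalIntegrable _ _)
        ((hψ.continuous_deriv (by simp)).intervalIntegrable _ _),
      apply_eq_zero_of_tsupport_subset hψt (x := 0) (by simp),
      apply_eq_zero_of_tsupport_subset hψt (x := 1) (by simp)]
    simp

theorem mutuallySingular_zero_left (μ : Measure ℝ) :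
    (0 : SignedMeasure ℝ) ⟂ᵥ μ.toENNRealVectorMeasure :=
  VectorMeasure.MutuallySingular.zero_left

/-- Uniqueness of the Lebesgue decomposition. It makes every `C¹` function satisfy the absolute
continuity requirement on test functions. -/
theorem singPart_withDensityᵥ (h : ℝ → ℝ) : singPart (volume.withDensityᵥ h) = 0 :=
  (SignedMeasure.eq_singularPart 0 h (mutuallySingular_zero_left _) (by simp)).symm

theorem acDensity_withDensityᵥ {h : ℝ → ℝ} (hh : Integrable h) :
    acDensity (volume.withDensityᵥ h) =ᵐ[volume] h :=
  (SignedMeasure.eq_rnDeriv 0 h hh (mutuallySingular_zero_left _) (by simp)).symm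

end SmoothTest

/-! ### One-sided essential limits. -/

section Traces

/-- Intervals to the right of `x` have positive measure. Properness of the filter is what makes
traces unique. -/
instance neBot_nhdsGT_inf_ae (x : ℝ) : (𝓝[>] x ⊓ ae (volume : Measure ℝ)).NeBot := by
  rw [inf_neBot_iff]
  intro s hs t ht
  obtain ⟨b, hb, hbs⟩ := mem_nhdsGT_iff_exists_Ioo_subset.1 hs
  by_contra hcon
  have hsub : Ioo x b ⊆ tᶜ := fun y hy hyt => hcon ⟨y, hbs hy, hyt⟩
  have h0 := measure_mono_null hsub (mem_ae_iff.1 ht)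
  rw [Real.volume_Ioo, ENNReal.ofReal_eq_zero] at h0
  have : x < b := hb
  linarith

instance neBot_nhdsLT_inf_ae (x : ℝ) : (𝓝[<] x ⊓ ae (volume : Measure ℝ)).NeBot := by
  rw [inf_neBot_iff]
  intro s hs t ht
  obtain ⟨b, hb, hbs⟩ := mem_nhdsLT_iff_exists_Ioo_subset.1 hs
  by_contra hcon
  have hsub : Ioo b x ⊆ tᶜ := fun y hy hyt => hcon ⟨y, hbs hy, hyt⟩
  have h0 := measure_mono_null hsub (mem_ae_iff.1 ht)
  rw [Real.volume_Ioo, ENNReal.ofReal_eq_zero] at h0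
  have : b < x := hb
  linarith

theorem isRightTrace_of_continuous {φ : ℝ → ℝ} (hφ : Continuous φ) (x : ℝ) :
    IsRightTrace φ x (φ x) :=
  hφ.continuousAt.mono_left (inf_le_left.trans nhdsWithin_le_nhds)

theorem isLeftTrace_of_continuous {φ : ℝ → ℝ} (hφ : Continuous φ) (x : ℝ) :
    IsLeftTrace φ x (φ x) :=
  hφ.continuousAt.mono_left (inf_le_left.trans nhdsWithin_le_nhds)

theorem IsRightTrace.eq_of_tendsto {u w : ℝ → ℝ} {a b : ℝ} (hu : IsRightTrace u 0 a)
    (huw : ∀ᵐ x ∂(volume.restrict (Ioo (0 : ℝ) 1)), u x = w x)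
    (hw : Tendsto w (𝓝[>] 0) (𝓝 b)) : a = b := by
  refine tendsto_nhds_unique hu (((hw.mono_left inf_le_left).congr' ?_))
  rw [ae_restrict_iff' measurableSet_Ioo] at huw
  filter_upwards [mem_inf_of_left (Ioo_mem_nhdsGT zero_lt_one), mem_inf_of_right huw] with x h1 h2
  exact (h2 h1).symm

theorem IsLeftTrace.eq_of_tendsto {u w : ℝ → ℝ} {a b : ℝ} (hu : IsLeftTrace u 1 a)
    (huw : ∀ᵐ x ∂(volume.restrict (Ioo (0 : ℝ) 1)), u x = w x)
    (hw : Tendsto w (𝓝[<] 1) (𝓝 b)) : a = b := by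
  refine tendsto_nhds_unique hu (((hw.mono_left inf_le_left).congr' ?_))
  rw [ae_restrict_iff' measurableSet_Ioo] at huw
  filter_upwards [mem_inf_of_left (Ioo_mem_nhdsLT zero_lt_one), mem_inf_of_right huw] with x h1 h2
  exact (h2 h1).symm

theorem tendsto_measureReal_of_tendsto_indicator {ι : Type*} {L : Filter ι}
    [L.IsCountablyGenerated] [L.NeBot] (μ : Measure ℝ) [IsFiniteMeasure μ] {s : ι → Set ℝ}
    {t : Set ℝ} (hs : ∀ i, MeasurableSet (s i)) (h : ∀ x, ∀ᶠ i in L, x ∈ s i ↔ x ∈ t) :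
    Tendsto (fun i => μ.real (s i)) L (𝓝 (μ.real t)) :=
  (ENNReal.tendsto_toReal (measure_ne_top _ _)).comp
    (tendsto_measure_of_tendsto_indicator_of_isFiniteMeasure L μ hs h)

theorem tendsto_signedMeasure_of_tendsto_indicator {ι : Type*} {L : Filter ι}
    [L.IsCountablyGenerated] [L.NeBot] (ν : SignedMeasure ℝ) {s : ι → Set ℝ}
    {t : Set ℝ} (hs : ∀ i, MeasurableSet (s i)) (ht : MeasurableSet t)
    (h : ∀ x, ∀ᶠ i in L, x ∈ s i ↔ x ∈ t) :
    Tendsto (fun i => ν (s i)) L (𝓝 (ν t)) := by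
  simp only [ν.apply_eq_posPart_real_sub_negPart_real (hs _),
    ν.apply_eq_posPart_real_sub_negPart_real ht]
  exact (tendsto_measureReal_of_tendsto_indicator _ hs h).sub
    (tendsto_measureReal_of_tendsto_indicator _ hs h)

theorem tendsto_signedMeasure_Iic_nhdsGT (ν : SignedMeasure ℝ) (a : ℝ) :
    Tendsto (fun x => ν (Iic x)) (𝓝[>] a) (𝓝 (ν (Iic a))) := by
  refine tendsto_signedMeasure_of_tendsto_indicator ν (fun _ => measurableSet_Iic)
    measurableSet_Iic fun t => ?_
  rcases le_or_gt t a with h | h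
  · filter_upwards [self_mem_nhdsWithin] with x hx
    exact iff_of_true (h.trans (le_of_lt hx)) h
  · filter_upwards [Ioo_mem_nhdsGT h] with x hx
    exact iff_of_false (not_le.2 hx.2) (not_le.2 h)

theorem tendsto_signedMeasure_Iic_nhdsLT (ν : SignedMeasure ℝ) (a : ℝ) :
    Tendsto (fun x => ν (Iic x)) (𝓝[<] a) (𝓝 (ν (Iio a))) := by
  refine tendsto_signedMeasure_of_tendsto_indicator ν (fun _ => measurableSet_Iic)
    measurableSet_Iio fun t => ?_
  rcases lt_or_ge t a with h | h
  · filter_upwards [Ioo_mem_nhdsLT h] with x hx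
    exact iff_of_true hx.1.le h
  · filter_upwards [self_mem_nhdsWithin] with x hx
    exact iff_of_false (not_le.2 (lt_of_lt_of_le hx h)) (not_lt.2 h)

end Traces

/-! ### BV functions as distribution functions. -/

section Representation

variable {u : ℝ → ℝ} {ν : SignedMeasure ℝ}

theorem HasDerivMeasure.apply_inter (h : HasDerivMeasure u ν) {s : Set ℝ} (hs : MeasurableSet s) :
    ν s = ν (s ∩ Ioo 0 1) := by
  conv_lhs => rw [← h.concentrated]
  rw [VectorMeasure.restrict_apply _ measurableSet_Ioo hs]

/-- A function of bounded variation is, up to a constant, the distribution function of its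
derivative. -/
theorem HasDerivMeasure.exists_ae_eq (h : HasDerivMeasure u ν) :
    ∃ c, ∀ᵐ x ∂(volume.restrict (Ioo (0 : ℝ) 1)), u x = c + ν (Iic x) := by
  have hν : IntegrableOn (fun x => ν (Iic x)) (Ioo 0 1) := by
    have := (integrable_mul_signedMeasure_Iic ((Ioo (0 : ℝ) 1).indicator 1)
      ((integrable_indicator_iff measurableSet_Ioo).2 (integrableOn_const (by simp))) ν)
    rw [← integrable_indicator_iff measurableSet_Ioo]
    refine this.congr (.of_forall fun x => ?_)
    by_cases hx : x ∈ Ioo (0 : ℝ) 1 <;> simp [hx]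
  -- Both functions have distributional derivative `ν`: by Fubini the second pairs with `ψ'` through
  -- `∫_t^∞ ψ' = -ψ(t)`.
  have key : ∃ c, ∀ᵐ x ∂(volume.restrict (Ioo (0 : ℝ) 1)), u x - ν (Iic x) = c := by
    refine exists_ae_eq_const_of_integral_mul_deriv_eq_zero
      (fun x => u x - ν (Iic x)) (h.integrable.sub hν) ?_
    intro ψ hψ hψs hψt
    have hψ1 : ContDiff ℝ 1 ψ := hψ.of_le (by simp)
    have hdc : Continuous (deriv ψ) := hψ1.continuous_deriv le_rfl
    obtain ⟨C, hC⟩ := hψs.deriv.exists_bound_of_continuous hdc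
    have e1 : ∫ x in Ioo (0 : ℝ) 1, ν (Iic x) * deriv ψ x = -∫ᵛ x, ψ x ∂<•ν := by
      rw [setIntegral_eq_integral_of_forall_compl_eq_zero]
      · simp_rw [mul_comm (ν (Iic _))]
        rw [integral_mul_signedMeasure_Iic _ (hdc.integrable_of_hasCompactSupport hψs.deriv),
          ← VectorMeasure.integral_fun_neg]
        congr 1
        ext t
        rw [integral_Ici_eq_integral_Ioi, hψs.integral_Ioi_deriv_eq hψ1]
      · intro x hx
        have : deriv ψ x = 0 := by
          by_contra hcon
          exact hx (hψt (support_deriv_subset hcon))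
        rw [this, mul_zero]
    simp only [sub_mul]
    rw [integral_sub (h.integrable.mul_bdd hdc.aestronglyMeasurable (.of_forall hC))
      (hν.mul_bdd hdc.aestronglyMeasurable (.of_forall hC)), e1, h.integral_eq ψ hψ hψs hψt,
      sub_self]
  obtain ⟨c, hc⟩ := key
  exact ⟨c, hc.mono fun x hx => by linarith⟩

/-- In `u = c + ν (Iic x)` the limits at `0` and `1` are `c` and `c + ν univ`, because `ν` is
concentrated on the open interval. -/
theorem HasDerivMeasure.apply_univ (h : HasDerivMeasure u ν) {u₀ u₁ : ℝ}
    (h0 : IsRightTrace u 0 u₀) (h1 : IsLeftTrace u 1 u₁) : ν univ = u₁ - u₀ := by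
  obtain ⟨c, hc⟩ := h.exists_ae_eq
  have e0 := h0.eq_of_tendsto hc (tendsto_const_nhds.add (tendsto_signedMeasure_Iic_nhdsGT ν 0))
  have e1 := h1.eq_of_tendsto hc (tendsto_const_nhds.add (tendsto_signedMeasure_Iic_nhdsLT ν 1))
  have s0 : Iic (0 : ℝ) ∩ Ioo 0 1 = ∅ := by ext x; simp; grind
  have s1 : Iio (1 : ℝ) ∩ Ioo 0 1 = univ ∩ Ioo 0 1 := by ext x; simp
  rw [h.apply_inter measurableSet_Iic, s0, VectorMeasure.empty] at e0
  rw [h.apply_inter measurableSet_Iio, s1, ← h.apply_inter .univ] at e1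
  linarith

end Representation

/-! ### The curvature flux and the equation it satisfies. -/

noncomputable section

/-- The weak formulation of the periodic problem with right-hand side `g`, for a function with
derivative `ν` and traces `u₀`, `u₁`. -/
def WeakEquation (g : ℝ → ℝ) (ν : SignedMeasure ℝ) (u₀ u₁ : ℝ) : Prop :=
  ∀ (φ : ℝ → ℝ) (κ : SignedMeasure ℝ) (φ₀ φ₁ : ℝ),
    HasDerivMeasure φ κ → IsRightTrace φ 0 φ₀ → IsLeftTrace φ 1 φ₁ →
    (singPart κ).totalVariation ≪ (singPart ν).totalVariation →
    (u₀ = u₁ → φ₀ = φ₁) →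
    (∫ x in Ioo (0 : ℝ) 1, acDensity ν x * acDensity κ x / √(1 + acDensity ν x ^ 2))
      + (∫ᵛ x, polarDensity (singPart ν) x ∂<•(singPart κ))
      + Real.sign (u₁ - u₀) * (φ₁ - φ₀)
      = ∫ x in Ioo (0 : ℝ) 1, g x * φ x

/-- The curvature flux `p ↦ p / √(1 + p²)`. -/
def flux (p : ℝ) : ℝ := p / √(1 + p ^ 2)

theorem continuous_flux : Continuous flux := by
  unfold flux
  refine continuous_id.div (by fun_prop) fun p => ?_
  positivity

theorem abs_flux_lt_one (p : ℝ) : |flux p| < 1 := by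
  have h : 0 < √(1 + p ^ 2) := by positivity
  rw [flux, abs_div, abs_of_pos h, div_lt_one h]
  exact Real.lt_sqrt_of_sq_lt (by rw [sq_abs]; linarith)

theorem one_sub_flux_sq (p : ℝ) : 1 - flux p ^ 2 = 1 / (1 + p ^ 2) := by
  have h : 0 < 1 + p ^ 2 := by positivity
  rw [flux, div_pow, Real.sq_sqrt h.le]
  field_simp
  ring

/-- The primitive vanishing at `0` of `g` restricted to `(0,1)`. -/
def primitive (g : ℝ → ℝ) (x : ℝ) : ℝ := ∫ t in (0 : ℝ)..x, (Ioo (0 : ℝ) 1).indicator g t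

variable {g : ℝ → ℝ}

theorem integrable_indicator_Ioo (hg : IntegrableOn g (Ioo 0 1)) :
    Integrable ((Ioo (0 : ℝ) 1).indicator g) :=
  (integrable_indicator_iff measurableSet_Ioo).2 hg

theorem continuous_primitive (hg : IntegrableOn g (Ioo 0 1)) : Continuous (primitive g) :=
  intervalIntegral.continuous_primitive
    (fun _ _ => (integrable_indicator_Ioo hg).intervalIntegrable) 0

theorem primitive_zero (g : ℝ → ℝ) : primitive g 0 = 0 := by simp [primitive]

theorem primitive_one (g : ℝ → ℝ) : primitive g 1 = ∫ x in Ioo (0 : ℝ) 1, g x := by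
  rw [primitive, ← setIntegral_Ioo_eq_intervalIntegral, setIntegral_indicator measurableSet_Ioo,
    inter_self]

theorem primitive_sub_primitive (hg : IntegrableOn g (Ioo 0 1)) (x y : ℝ) :
    primitive g y - primitive g x = ∫ t in x..y, (Ioo (0 : ℝ) 1).indicator g t :=
  intervalIntegral.integral_interval_sub_left (integrable_indicator_Ioo hg).intervalIntegrable
    (integrable_indicator_Ioo hg).intervalIntegrable

theorem primitive_of_nonpos {x : ℝ} (hx : x ≤ 0) : primitive g x = 0 := by
  refine (intervalIntegral.integral_congr (g := fun _ => (0 : ℝ)) fun t ht => ?_).trans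
    intervalIntegral.integral_zero
  rw [uIcc_of_ge hx] at ht
  exact indicator_of_notMem (fun h => h.1.not_ge ht.2) _

theorem primitive_of_one_le (hg : IntegrableOn g (Ioo 0 1)) {x : ℝ} (hx : 1 ≤ x) :
    primitive g x = primitive g 1 := by
  rw [← sub_eq_zero, primitive_sub_primitive hg]
  refine (intervalIntegral.integral_congr (g := fun _ => (0 : ℝ)) fun t ht => ?_).trans
    intervalIntegral.integral_zero
  rw [uIcc_of_le hx] at ht
  exact indicator_of_notMem (fun h => h.2.not_ge ht.1) _

theorem absolutelyContinuousOnInterval_primitive (hg : IntegrableOn g (Ioo 0 1)) :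
    AbsolutelyContinuousOnInterval (primitive g) 0 1 :=
  (integrable_indicator_Ioo hg).intervalIntegrable.absolutelyContinuousOnInterval_intervalIntegral
    (by simp)

theorem ae_hasDerivAt_primitive (hg : IntegrableOn g (Ioo 0 1)) :
    ∀ᵐ x ∂(volume.restrict (Ioo (0 : ℝ) 1)), HasDerivAt (primitive g) (g x) x := by
  rw [ae_restrict_iff' measurableSet_Ioo]
  filter_upwards [LocallyIntegrable.ae_hasDerivAt_integral
    (integrable_indicator_Ioo hg).locallyIntegrable]
    with x hx hx'
  have := hx 0
  rwa [indicator_of_mem hx'] at this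

theorem setIntegral_mul_deriv_eq {φ w w' : ℝ → ℝ} (hw : AbsolutelyContinuousOnInterval w 0 1)
    (hw' : ∀ᵐ x ∂(volume.restrict (Ioo (0 : ℝ) 1)), HasDerivAt w (w' x) x)
    (hφ : ContDiff ℝ 1 φ) :
    ∫ x in Ioo (0 : ℝ) 1, w x * deriv φ x
      = w 1 * φ 1 - w 0 * φ 0 - ∫ x in Ioo (0 : ℝ) 1, w' x * φ x := by
  rw [setIntegral_Ioo_eq_intervalIntegral,
    hw.integral_mul_deriv_eq_deriv_mul hφ.contDiffOn.absolutelyContinuousOnInterval,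
    ← setIntegral_Ioo_eq_intervalIntegral]
  congr 1
  refine integral_congr_ae ?_
  filter_upwards [hw'] with x hx
  rw [hx.deriv]

theorem setIntegral_mul_eq (hg : IntegrableOn g (Ioo 0 1)) {φ : ℝ → ℝ} (hφ : ContDiff ℝ 1 φ) :
    ∫ x in Ioo (0 : ℝ) 1, g x * φ x
      = primitive g 1 * φ 1 - ∫ x in Ioo (0 : ℝ) 1, primitive g x * deriv φ x := by
  rw [setIntegral_mul_deriv_eq (absolutelyContinuousOnInterval_primitive hg)
    (ae_hasDerivAt_primitive hg) hφ, primitive_zero]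
  ring

variable {ν : SignedMeasure ℝ} {u₀ u₁ : ℝ}

/-- The singular term disappears because `Dφ = φ' dx`. -/
theorem WeakEquation.of_contDiff (h : WeakEquation g ν u₀ u₁) {φ : ℝ → ℝ} (hφ : ContDiff ℝ 1 φ)
    (hper : u₀ = u₁ → φ 0 = φ 1) :
    (∫ x in Ioo (0 : ℝ) 1, flux (acDensity ν x) * deriv φ x)
      + Real.sign (u₁ - u₀) * (φ 1 - φ 0) = ∫ x in Ioo (0 : ℝ) 1, g x * φ x := by
  have := h φ _ (φ 0) (φ 1) (hasDerivMeasure_of_contDiff hφ)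
    (isRightTrace_of_continuous hφ.continuous 0) (isLeftTrace_of_continuous hφ.continuous 1)
    (by rw [singPart_withDensityᵥ, SignedMeasure.totalVariation_zero]
        exact Measure.AbsolutelyContinuous.zero _) hper
  rw [singPart_withDensityᵥ, VectorMeasure.integral_zero_vectorMeasure, add_zero] at this
  rw [← this]
  congr 1
  refine setIntegral_congr_ae measurableSet_Ioo ?_
  filter_upwards [acDensity_withDensityᵥ (integrable_indicator_deriv hφ)] with x hx hx'
  rw [hx, indicator_of_mem hx', flux]
  ring

theorem measurable_acDensity (ν : SignedMeasure ℝ) : Measurable (acDensity ν) :=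
  SignedMeasure.measurable_rnDeriv _ _

theorem integrable_acDensity (ν : SignedMeasure ℝ) : Integrable (acDensity ν) :=
  SignedMeasure.integrable_rnDeriv _ _

theorem integrableOn_flux (ν : SignedMeasure ℝ) :
    IntegrableOn (fun x => flux (acDensity ν x)) (Ioo 0 1) :=
  Measure.integrableOn_of_bounded (M := 1) (by simp)
    (continuous_flux.measurable.comp (measurable_acDensity ν)).aestronglyMeasurable
    (.of_forall fun x => (abs_flux_lt_one _).le)

theorem WeakEquation.primitive_one_eq_zero (h : WeakEquation g ν u₀ u₁) : primitive g 1 = 0 := by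
  have := h.of_contDiff (φ := fun _ => 1) contDiff_const (fun _ => rfl)
  simpa [primitive_one] using this.symm

/-- The flux of a solution is an absolutely continuous function, and its boundary value is
determined by the jump of the solution at the end points. -/
theorem WeakEquation.exists_flux_eq (h : WeakEquation g ν u₀ u₁)
    (hg : IntegrableOn g (Ioo 0 1)) :
    ∃ C, (∀ᵐ x ∂(volume.restrict (Ioo (0 : ℝ) 1)), flux (acDensity ν x) = C - primitive g x) ∧
      (u₀ ≠ u₁ → Real.sign (u₁ - u₀) = -C) := by
  have hT := integrableOn_flux ν
  have hG : IntegrableOn (primitive g) (Ioo 0 1) :=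
    continuous_integrableOn_Ioo (continuous_primitive hg) _ _
  have key : ∃ C, ∀ᵐ x ∂(volume.restrict (Ioo (0 : ℝ) 1)),
      flux (acDensity ν x) + primitive g x = C := by
    refine exists_ae_eq_const_of_integral_mul_deriv_eq_zero _ (hT.add hG) fun ψ hψ hψs hψt => ?_
    have hψ1 : ContDiff ℝ 1 ψ := hψ.of_le (by simp)
    have z0 : ψ 0 = 0 := apply_eq_zero_of_tsupport_subset hψt (by simp)
    have z1 : ψ 1 = 0 := apply_eq_zero_of_tsupport_subset hψt (by simp)
    have e := h.of_contDiff hψ1 (fun _ => z0.trans z1.symm)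
    rw [setIntegral_mul_eq hg hψ1, z0, z1] at e
    have hdc : Continuous (deriv ψ) := hψ1.continuous_deriv le_rfl
    obtain ⟨K, hK⟩ := hψs.deriv.exists_bound_of_continuous hdc
    simp only [add_mul]
    rw [integral_add (hT.mul_bdd hdc.aestronglyMeasurable (.of_forall hK))
      (hG.mul_bdd hdc.aestronglyMeasurable (.of_forall hK))]
    linarith
  obtain ⟨C, hC⟩ := key
  refine ⟨C, hC.mono fun x hx => by linarith, fun hne => ?_⟩
  -- With different traces `φ` need not be periodic. This test gives `∫ T + sgn(u₁ - u₀) = -∫ G`, to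
  -- be compared with `∫ T = C - ∫ G`.
  have e := h.of_contDiff (φ := id) contDiff_id (fun h => absurd h hne)
  rw [setIntegral_mul_eq hg contDiff_id, h.primitive_one_eq_zero] at e
  simp only [deriv_id, mul_one, id, sub_zero, zero_sub] at e
  have hTi : ∫ x in Ioo (0 : ℝ) 1, flux (acDensity ν x)
      = C - ∫ x in Ioo (0 : ℝ) 1, primitive g x := by
    have h1 : ∫ x in Ioo (0 : ℝ) 1, (C - primitive g x)
        = C - ∫ x in Ioo (0 : ℝ) 1, primitive g x := by
      rw [integral_sub (integrable_const C) hG]; simp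
    rw [← h1]
    exact integral_congr_ae (hC.mono fun x hx => by simp only; linarith)
  linarith

end

/-! ### The decay conditions keep the flux away from `±1`. -/

section Decay

/-- From `(1 - |T|)(1 + |T|) = 1 / (1 + p²)` and `1 + |T| < 2` one gets `1 / (1 + p²) ≤ 2m`; then `1
+ p² ≤ (1 + |p|)²`. The constant `2` is not sharp. -/
theorem one_div_sqrt_le_of_one_sub_abs_flux_le {p m : ℝ} (h : 1 - |flux p| ≤ m) :
    1 / √m ≤ 2 * (1 + |p|) := by
  have h1 := one_sub_flux_sq p
  have h2 := abs_flux_lt_one p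
  have hp := abs_nonneg p
  have h3 : 1 / (1 + p ^ 2) ≤ 2 * m := by
    rw [← h1, ← sq_abs]
    nlinarith [abs_nonneg (flux p)]
  have h4 : (1 / (2 * (1 + |p|))) ^ 2 ≤ m := by
    have : (1 / (2 * (1 + |p|))) ^ 2 ≤ 1 / (1 + p ^ 2) / 2 := by
      rw [div_pow, one_pow, div_div]
      refine one_div_le_one_div_of_le (by positivity) ?_
      rw [← sq_abs p]
      nlinarith
    linarith
  have h5 : 1 / (2 * (1 + |p|)) ≤ √m := Real.le_sqrt_of_sq_le h4
  exact (one_div_le (lt_of_lt_of_le (by positivity) h5) (by positivity)).2 h5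

theorem lintegral_one_div_sqrt_ne_top {a M : ℝ → ℝ} (ha : Integrable a) {s : Set ℝ}
    (hsv : volume s ≠ ⊤)
    (h : ∀ᵐ x ∂(volume.restrict s), 1 - |flux (a x)| ≤ M x) :
    ∫⁻ x in s, ENNReal.ofReal (1 / √(M x)) ≠ ⊤ := by
  have hi : IntegrableOn (fun x => 2 * (1 + |a x|)) s :=
    ((integrableOn_const hsv).add ha.abs.integrableOn).const_mul 2
  refine ne_top_of_le_ne_top hi.lintegral_lt_top.ne (lintegral_mono_ae ?_)
  filter_upwards [h] with x hx
  exact ENNReal.ofReal_le_ofReal (one_div_sqrt_le_of_one_sub_abs_flux_le hx)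

variable {a g : ℝ → ℝ}

theorem primitive_sub_le_of_ae_le (hg : IntegrableOn g (Ioo 0 1)) {μ : ℝ → ℝ} {p q x y : ℝ}
    (hμ : IntegrableOn μ (Ioo p q)) (hp : 0 ≤ p) (hq : q ≤ 1)
    (h : ∀ᵐ x ∂(volume.restrict (Ioo p q)), g x ≤ μ x) (hpx : p ≤ x) (hxy : x ≤ y)
    (hyq : y ≤ q) : primitive g y - primitive g x ≤ ∫ t in x..y, μ t := by
  rw [primitive_sub_primitive hg]
  have hsub : Ioo x y ⊆ Ioo p q := Ioo_subset_Ioo hpx hyq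
  refine intervalIntegral.integral_mono_ae_restrict hxy
    (integrable_indicator_Ioo hg).intervalIntegrable
    ((intervalIntegrable_iff_integrableOn_Ioo_of_le hxy).2 (hμ.mono_set hsub)) ?_
  rw [← restrict_Ioo_eq_restrict_Icc]
  have h' := ae_restrict_of_ae_restrict_of_subset hsub h
  filter_upwards [h', ae_restrict_mem measurableSet_Ioo] with t ht htm
  rw [indicator_of_mem (Ioo_subset_Ioo hp hq (hsub htm))]
  exact ht

/-- The forbidden inequality is what a flux of modulus one at `b` would produce. It bounds `1 - |T|`
by `∫_x^b μ`, so `1 / √M` would be integrable. -/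
theorem DecayLeft.not_ae_le {b : ℝ} (h : DecayLeft g b) (hb : b ≤ 1)
    (hg : IntegrableOn g (Ioo 0 1)) (ha : Integrable a) :
    ¬ ∀ᵐ x ∂(volume.restrict (Ioo 0 b)), 1 - |flux (a x)| ≤ primitive g b - primitive g x := by
  intro hle
  obtain ⟨δ, hδ, hδb, μ, hμ, hgμ, -, htop⟩ := h
  refine lintegral_one_div_sqrt_ne_top ha (by simp) ?_ htop
  filter_upwards [ae_restrict_of_ae_restrict_of_subset (Ioo_subset_Ioo_left hδb) hle,
    ae_restrict_mem measurableSet_Ioo] with x hx hxm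
  exact hx.trans (primitive_sub_le_of_ae_le hg hμ hδb hb hgμ hxm.1.le hxm.2.le le_rfl)

theorem DecayRight.not_ae_le {b : ℝ} (h : DecayRight g b) (hb : 0 ≤ b)
    (hg : IntegrableOn g (Ioo 0 1)) (ha : Integrable a) :
    ¬ ∀ᵐ x ∂(volume.restrict (Ioo b 1)), 1 - |flux (a x)| ≤ primitive g x - primitive g b := by
  intro hle
  obtain ⟨δ, hδ, hδb, μ, hμ, hgμ, -, htop⟩ := h
  refine lintegral_one_div_sqrt_ne_top ha (by simp) ?_ htop
  filter_upwards [ae_restrict_of_ae_restrict_of_subset (Ioo_subset_Ioo_right hδb) hle,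
    ae_restrict_mem measurableSet_Ioo] with x hx hxm
  exact hx.trans (primitive_sub_le_of_ae_le hg hμ hb hδb hgμ le_rfl hxm.1.le hxm.2.le)

theorem primitive_neg (g : ℝ → ℝ) (x : ℝ) : primitive (fun t => -g t) x = -primitive g x := by
  rw [primitive, primitive, ← intervalIntegral.integral_neg]
  congr 1
  ext t
  by_cases ht : t ∈ Ioo (0 : ℝ) 1 <;> simp [ht]

/-- The exceptional set inside `(0,1)` is open and null, hence empty; the end points follow by
closure. -/
theorem abs_le_of_ae_le {H : ℝ → ℝ} (hH : Continuous H)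
    (h : ∀ᵐ x ∂(volume.restrict (Ioo (0 : ℝ) 1)), |H x| ≤ 1) {x : ℝ} (hx : x ∈ Icc (0 : ℝ) 1) :
    |H x| ≤ 1 := by
  have hclosed : IsClosed {x | |H x| ≤ 1} := isClosed_le hH.abs continuous_const
  have hopen : IsOpen ({x | |H x| ≤ 1}ᶜ ∩ Ioo (0 : ℝ) 1) := hclosed.isOpen_compl.inter isOpen_Ioo
  have h0 : volume ({x | |H x| ≤ 1}ᶜ ∩ Ioo (0 : ℝ) 1) = 0 := by
    rwa [ae_iff, Measure.restrict_apply₀' measurableSet_Ioo.nullMeasurableSet] at h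
  have hemp := (hopen.measure_eq_zero_iff volume).1 h0
  have hsub : Ioo (0 : ℝ) 1 ⊆ {x | |H x| ≤ 1} := fun y hy => by
    by_contra hcon
    exact hemp.subset ⟨hcon, hy⟩
  rw [← closure_Ioo zero_ne_one] at hx
  exact closure_minimal hsub hclosed hx

theorem primitive_monotone_of_nonneg (hg : IntegrableOn g (Ioo 0 1)) {p q : ℝ}
    (h : ∀ᵐ x ∂(volume.restrict (Ioo p q)), 0 ≤ g x) {x y : ℝ} (hpx : p ≤ x) (hxy : x ≤ y)
    (hyq : y ≤ q) : primitive g x ≤ primitive g y := by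
  rw [← sub_nonneg, primitive_sub_primitive hg, intervalIntegral.integral_of_le hxy,
    integral_Ioc_eq_integral_Ioo]
  refine integral_nonneg_of_ae ?_
  filter_upwards [ae_restrict_of_ae_restrict_of_subset (Ioo_subset_Ioo hpx hyq) h] with t ht
  by_cases htm : t ∈ Ioo (0 : ℝ) 1 <;> simp [htm, ht]

/-- Under the decay conditions, the flux of a solution stays away from `±1`. -/
theorem abs_sub_primitive_lt_one {C z : ℝ} (hz : z ∈ Ioo (0 : ℝ) 1)
    (hg : IntegrableOn g (Ioo 0 1)) (hg0 : primitive g 1 = 0) (ha : Integrable a)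
    (hflux : ∀ᵐ x ∂(volume.restrict (Ioo (0 : ℝ) 1)), flux (a x) = C - primitive g x)
    (hpos : ∀ᵐ x ∂(volume.restrict (Ioo 0 z)), 0 ≤ g x)
    (hneg : ∀ᵐ x ∂(volume.restrict (Ioo z 1)), g x ≤ 0)
    (hdecay_z : DecayLeft g z ∨ DecayRight (fun x => -g x) z)
    (hdecay_end : DecayRight g 0 ∨ DecayLeft (fun x => -g x) 1) (x : ℝ) :
    |C - primitive g x| < 1 := by
  have hle : ∀ x ∈ Icc (0 : ℝ) 1, |C - primitive g x| ≤ 1 := fun x hx =>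
    abs_le_of_ae_le (H := fun x => C - primitive g x) (continuous_const.sub (continuous_primitive hg))
      (hflux.mono fun x hx => by rw [← hx]; exact (abs_flux_lt_one _).le) hx
  have hC1 : C ≤ 1 := by
    have := hle 0 (by simp)
    rw [primitive_zero, sub_zero] at this
    exact (abs_le.1 this).2
  have hfluxL := ae_restrict_of_ae_restrict_of_subset (Ioo_subset_Ioo_right hz.2.le) hflux
  have hfluxR := ae_restrict_of_ae_restrict_of_subset (Ioo_subset_Ioo_left hz.1.le) hflux
  -- If `C = 1`, then `1 - |T| ≤ 1 - T = G(x)`, which is both `G(x) - G(0)` and `G(x) - G(1)`: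
  -- either end yields a contradiction.
  have hC : C < 1 := by
    refine lt_of_le_of_ne hC1 fun hCe => ?_
    rcases hdecay_end with h | h
    · refine h.not_ae_le le_rfl hg ha (hflux.mono fun x hx => ?_)
      rw [hx, primitive_zero]
      linarith [le_abs_self (C - primitive g x)]
    · refine h.not_ae_le le_rfl hg.neg ha (hflux.mono fun x hx => ?_)
      rw [hx, primitive_neg, primitive_neg, hg0]
      linarith [le_abs_self (C - primitive g x)]
  -- If `C - G(z) = -1`, then `1 - |T| ≤ 1 + T = G(z) - G(x)` on both sides of `z`.
  have hz1 : -1 < C - primitive g z := by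
    refine lt_of_le_of_ne (abs_le.1 (hle z ⟨hz.1.le, hz.2.le⟩)).1 fun hCe => ?_
    rcases hdecay_z with h | h
    · refine h.not_ae_le hz.2.le hg ha (hfluxL.mono fun x hx => ?_)
      rw [hx]
      linarith [neg_abs_le (C - primitive g x)]
    · refine h.not_ae_le hz.1.le hg.neg ha (hfluxR.mono fun x hx => ?_)
      rw [hx, primitive_neg, primitive_neg]
      linarith [neg_abs_le (C - primitive g x)]
  have hneg' : ∀ᵐ x ∂(volume.restrict (Ioo z 1)), 0 ≤ -g x := hneg.mono fun x hx => by linarith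
  -- Outside `[0,1]` the primitive is constantly `0`, so the bound holds on the whole line.
  have hbounds : ∀ x, 0 ≤ primitive g x ∧ primitive g x ≤ primitive g z := by
    intro x
    have hz0 : 0 ≤ primitive g z := by
      rw [← primitive_zero g]
      exact primitive_monotone_of_nonneg hg hpos le_rfl hz.1.le le_rfl
    rcases le_total x 0 with h0 | h0
    · rw [primitive_of_nonpos h0]
      exact ⟨le_rfl, hz0⟩
    rcases le_total 1 x with h1 | h1
    · rw [primitive_of_one_le hg h1, hg0]
      exact ⟨le_rfl, hz0⟩
    rcases le_total x z with hxz | hxz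
    · refine ⟨?_, primitive_monotone_of_nonneg hg hpos h0 hxz le_rfl⟩
      rw [← primitive_zero g]
      exact primitive_monotone_of_nonneg hg hpos le_rfl h0 hxz
    · have e1 := primitive_monotone_of_nonneg hg.neg hneg' le_rfl hxz h1
      have e2 := primitive_monotone_of_nonneg hg.neg hneg' hxz h1 le_rfl
      simp only [Pi.neg_def, primitive_neg, hg0] at e1 e2
      exact ⟨by linarith, by linarith⟩
  obtain ⟨h1, h2⟩ := hbounds x
  rw [abs_lt]
  exact ⟨by linarith, by linarith⟩

end Decay

noncomputable section

/-! ### The singular part vanishes. -/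

section SingularPart

variable {g u : ℝ → ℝ} {ν : SignedMeasure ℝ} {u₀ u₁ C : ℝ}

theorem setIntegral_Ici_indicator (hg : IntegrableOn g (Ioo 0 1)) (hg0 : primitive g 1 = 0)
    (t : ℝ) : ∫ x in Ici t, (Ioo (0 : ℝ) 1).indicator g x = -primitive g t := by
  have hi := integrable_indicator_Ioo hg
  have e := intervalIntegral.integral_interval_add_Ioi (a := 0) (b := t) hi.integrableOn
    hi.integrableOn
  rw [setIntegral_indicator measurableSet_Ioo (s := Ioi 0),
    inter_eq_right.2 Ioo_subset_Ioi_self, ← primitive_one, hg0] at e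
  rw [integral_Ici_eq_integral_Ioi]
  exact eq_neg_of_add_eq_zero_right e

/-- Insert `u = c + ν (Iic x)`: the constant drops out since `∫ g = 0`, and Fubini turns the rest
into `∫ -G dν`. Adding `C` is free because equal traces mean `ν univ = 0`. -/
theorem WeakEquation.integral_mul_solution (h : WeakEquation g ν u₀ u₁)
    (hu : HasDerivMeasure u ν) (h0 : IsRightTrace u 0 u₀) (h1 : IsLeftTrace u 1 u₁)
    (heq : u₀ = u₁) (hg : IntegrableOn g (Ioo 0 1)) (C : ℝ)
    (hH : ∀ x, |C - primitive g x| < 1) :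
    ∫ x in Ioo (0 : ℝ) 1, g x * u x = ∫ᵛ x, (C - primitive g x) ∂<•ν := by
  have hg0 := h.primitive_one_eq_zero
  obtain ⟨c, hc⟩ := hu.exists_ae_eq
  have hi := integrable_indicator_Ioo hg
  have e1 : ∫ x in Ioo (0 : ℝ) 1, g x * u x
      = ∫ x, ((Ioo (0 : ℝ) 1).indicator g x * c
        + (Ioo (0 : ℝ) 1).indicator g x * ν (Iic x)) := by
    rw [← integral_indicator measurableSet_Ioo]
    refine integral_congr_ae ?_
    rw [ae_restrict_iff' measurableSet_Ioo] at hc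
    filter_upwards [hc] with x hx
    by_cases hm : x ∈ Ioo (0 : ℝ) 1
    · simp only [indicator_of_mem hm, hx hm]; ring
    · simp [hm]
  rw [e1, integral_add (hi.mul_const c) (integrable_mul_signedMeasure_Iic _ hi ν),
    integral_mul_const, integral_indicator measurableSet_Ioo, ← primitive_one, hg0, zero_mul,
    zero_add, integral_mul_signedMeasure_Iic _ hi]
  simp only [setIntegral_Ici_indicator hg hg0]
  have : IsFiniteMeasure ν.variation := by
    rw [← SignedMeasure.totalVariation_eq_variation]; infer_instance
  have hHi : ν.Integrable fun x => C - primitive g x :=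
    Integrable.of_bound (continuous_const.sub (continuous_primitive hg)).aestronglyMeasurable 1
      (.of_forall fun x => (hH x).le)
  have e2 := VectorMeasure.integral_fun_sub
    (B := (ContinuousLinearMap.lsmul ℝ ℝ (E := ℝ)).flip) hHi (integrable_const (μ := ν.variation) C)
  rw [VectorMeasure.integral_const, hu.apply_univ h0 h1, heq, sub_self, map_zero, sub_zero] at e2
  rw [← e2]
  congr 1
  ext x
  ring

theorem HasDerivMeasure.integral_indicator (hu : HasDerivMeasure u ν) (H : ℝ → ℝ) :
    ∫ᵛ x, H x ∂<•ν = ∫ᵛ x, (Ioo (0 : ℝ) 1).indicator H x ∂<•ν := by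
  refine VectorMeasure.integral_congr_ae ?_
  have : ∀ᵐ x ∂ν.variation, x ∈ Ioo (0 : ℝ) 1 := by
    rw [← hu.concentrated, VectorMeasure.variation_restrict measurableSet_Ioo]
    exact ae_restrict_mem measurableSet_Ioo
  filter_upwards [this] with x hx
  rw [indicator_of_mem hx]

theorem singPart_add_withDensityᵥ (ν : SignedMeasure ℝ) :
    singPart ν + volume.withDensityᵥ (acDensity ν) = ν :=
  SignedMeasure.singularPart_add_withDensity_rnDeriv_eq volume ν

/-- Test with `u`. Since `T = C - G`, the absolutely continuous parts of both sides cancel; the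
polar density and `C - G` then have the same integral against `Dˢu`, although only the former has
modulus one. -/
theorem WeakEquation.singPart_eq_zero (h : WeakEquation g ν u₀ u₁)
    (hu : HasDerivMeasure u ν) (h0 : IsRightTrace u 0 u₀) (h1 : IsLeftTrace u 1 u₁)
    (heq : u₀ = u₁) (hg : IntegrableOn g (Ioo 0 1))
    (hflux : ∀ᵐ x ∂(volume.restrict (Ioo (0 : ℝ) 1)), flux (acDensity ν x) = C - primitive g x)
    (hH : ∀ x, |C - primitive g x| < 1) : singPart ν = 0 := by
  set H : ℝ → ℝ := (Ioo (0 : ℝ) 1).indicator fun x => C - primitive g x with hHdef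
  have hHm : Measurable H :=
    (continuous_const.sub (continuous_primitive hg)).measurable.indicator measurableSet_Ioo
  have hH1 : ∀ x, |H x| < 1 := fun x => by
    by_cases hx : x ∈ Ioo (0 : ℝ) 1
    · rw [hHdef, indicator_of_mem hx]; exact hH x
    · rw [hHdef, indicator_of_notMem hx]; simp
  have hHi : ∀ τ : SignedMeasure ℝ, τ.Integrable H := fun τ => by
    have : IsFiniteMeasure τ.variation := by
      rw [← SignedMeasure.totalVariation_eq_variation]; infer_instance
    exact Integrable.of_bound hHm.aestronglyMeasurable 1 (.of_forall fun x => (hH1 x).le)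
  refine eq_zero_of_integral_rnDeriv_eq _ H hHm hH1 ?_
  have e := h u ν u₀ u₁ hu h0 h1 Measure.AbsolutelyContinuous.rfl id
  rw [h.integral_mul_solution hu h0 h1 heq hg C hH, hu.integral_indicator, heq, sub_self,
    mul_zero, add_zero] at e
  have e2 : ∫ᵛ x, H x ∂<•ν = (∫ᵛ x, H x ∂<•(singPart ν)) + ∫ x, H x * acDensity ν x := by
    conv_lhs => rw [← singPart_add_withDensityᵥ ν]
    rw [VectorMeasure.integral_add_vectorMeasure (hHi _) (hHi _),
      integral_withDensityᵥ volume _ H (integrable_acDensity ν) hHm fun x => (hH1 x).le]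
  have e3 : ∫ x in Ioo (0 : ℝ) 1, acDensity ν x * acDensity ν x / √(1 + acDensity ν x ^ 2)
      = ∫ x, H x * acDensity ν x := by
    rw [← MeasureTheory.integral_indicator measurableSet_Ioo]
    rw [ae_restrict_iff' measurableSet_Ioo] at hflux
    refine integral_congr_ae ?_
    filter_upwards [hflux] with x hx
    by_cases hm : x ∈ Ioo (0 : ℝ) 1
    · rw [hHdef, indicator_of_mem hm, indicator_of_mem hm, ← hx hm, flux]
      ring
    · rw [hHdef, indicator_of_notMem hm, indicator_of_notMem hm, zero_mul]
  change _ + (∫ᵛ x, polarDensity (singPart ν) x ∂<•(singPart ν)) = ∫ᵛ x, H x ∂<•ν at e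
  rw [e2, e3, add_comm] at e
  exact add_right_cancel e

end SingularPart

/-! ### The inverse flux and Lipschitz composition. -/

section InverseFlux

/-- The inverse `h ↦ h / √(1 - h²)` of the curvature flux. -/
def invFlux (h : ℝ) : ℝ := h / √(1 - h ^ 2)

theorem one_sub_sq_pos {h : ℝ} (hh : |h| < 1) : 0 < 1 - h ^ 2 := by
  rw [sub_pos]; exact (sq_lt_one_iff_abs_lt_one h).2 hh

theorem invFlux_flux (p : ℝ) : invFlux (flux p) = p := by
  have h : 0 < 1 + p ^ 2 := by positivity
  rw [invFlux, one_sub_flux_sq, Real.sqrt_div zero_le_one, Real.sqrt_one, flux]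
  have := (Real.sqrt_pos.2 h).ne'
  field_simp

theorem flux_invFlux {h : ℝ} (hh : |h| < 1) : flux (invFlux h) = h := by
  have h1 := one_sub_sq_pos hh
  have h2 := (Real.sqrt_pos.2 h1).ne'
  have h3 : 1 + invFlux h ^ 2 = 1 / (1 - h ^ 2) := by
    rw [invFlux, div_pow, Real.sq_sqrt h1.le]
    field_simp
    ring
  rw [flux, h3, Real.sqrt_div zero_le_one, Real.sqrt_one, invFlux]
  field_simp

theorem contDiffOn_invFlux : ContDiffOn ℝ 1 invFlux (Ioo (-1) 1) := by
  have hpos : ∀ h ∈ Ioo (-1 : ℝ) 1, 0 < 1 - h ^ 2 := fun h hh => one_sub_sq_pos (abs_lt.2 hh)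
  exact contDiffOn_id.div ((contDiffOn_const.sub (contDiffOn_id.pow 2)).sqrt
    fun h hh => (hpos h hh).ne') fun h hh => (Real.sqrt_pos.2 (hpos h hh)).ne'

theorem _root_.LipschitzOnWith.comp_absolutelyContinuousOnInterval {ψ f : ℝ → ℝ} {s : Set ℝ}
    {K : NNReal} {a b : ℝ} (hψ : LipschitzOnWith K ψ s) (hf : AbsolutelyContinuousOnInterval f a b)
    (hs : MapsTo f (uIcc a b) s) : AbsolutelyContinuousOnInterval (fun x => ψ (f x)) a b := by
  rw [absolutelyContinuousOnInterval_iff] at hf ⊢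
  intro ε hε
  -- `K + 1` rather than `K`, since `K` may be zero.
  obtain ⟨δ, hδ, h⟩ := hf (ε / (K + 1)) (by positivity)
  refine ⟨δ, hδ, fun E hE hlt => ?_⟩
  calc ∑ i ∈ Finset.range E.1, dist (ψ (f (E.2 i).1)) (ψ (f (E.2 i).2))
      ≤ ∑ i ∈ Finset.range E.1, K * dist (f (E.2 i).1) (f (E.2 i).2) :=
        Finset.sum_le_sum fun i hi =>
          hψ.dist_le_mul _ (hs (hE.1 i hi).1) _ (hs (hE.1 i hi).2)
    _ = K * ∑ i ∈ Finset.range E.1, dist (f (E.2 i).1) (f (E.2 i).2) :=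
        (Finset.mul_sum _ _ _).symm
    _ ≤ K * (ε / (K + 1)) := by
        gcongr
        exact (h E hE hlt).le
    _ < (K + 1) * (ε / (K + 1)) := by gcongr; linarith
    _ = ε := by field

end InverseFlux

end

/-! ### Sobolev regularity. -/

section Regularity

variable {g u : ℝ → ℝ} {ν : SignedMeasure ℝ} {C : ℝ}

/-- Without a singular part `ν` is its density times Lebesgue measure, so the distribution function
is an ordinary primitive. -/
theorem HasDerivMeasure.exists_ae_eq_integral (hu : HasDerivMeasure u ν) (hs : singPart ν = 0)
    {V : ℝ → ℝ} (hV : ∀ᵐ x ∂(volume.restrict (Ioo (0 : ℝ) 1)), acDensity ν x = V x) :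
    ∃ c, ∀ᵐ x ∂(volume.restrict (Ioo (0 : ℝ) 1)), u x = c + ∫ t in (0 : ℝ)..x, V t := by
  obtain ⟨c, hc⟩ := hu.exists_ae_eq
  refine ⟨c, ?_⟩
  filter_upwards [hc, ae_restrict_mem measurableSet_Ioo] with x hx hm
  have hset : Iic x ∩ Ioo 0 1 = Ioc 0 x := by
    ext y
    simp only [mem_inter_iff, mem_Iic, mem_Ioo, mem_Ioc]
    exact ⟨fun h => ⟨h.2.1, h.1⟩, fun h => ⟨h.2, h.1, h.2.trans_lt hm.2⟩⟩
  have hν : ν = volume.withDensityᵥ (acDensity ν) := by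
    conv_lhs => rw [← singPart_add_withDensityᵥ ν, hs, zero_add]
  rw [hx, hu.apply_inter measurableSet_Iic, hset, hν,
    withDensityᵥ_apply (integrable_acDensity ν) measurableSet_Ioc,
    intervalIntegral.integral_of_le hm.1.le]
  congr 1
  have hsub : Ioc 0 x ⊆ Ioo 0 1 := fun y hy => ⟨hy.1, hy.2.trans_lt hm.2⟩
  exact integral_congr_ae (ae_restrict_of_ae_restrict_of_subset hsub hV)

theorem hasWeakDeriv_of_absolutelyContinuous {w w' : ℝ → ℝ}
    (hw : AbsolutelyContinuousOnInterval w 0 1)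
    (hw' : ∀ᵐ x ∂(volume.restrict (Ioo (0 : ℝ) 1)), HasDerivAt w (w' x) x) :
    HasWeakDeriv w w' := by
  intro φ hφ hφs hφt
  rw [setIntegral_mul_deriv_eq hw hw' (hφ.of_le (by simp)),
    apply_eq_zero_of_tsupport_subset hφt (x := 0) (by simp),
    apply_eq_zero_of_tsupport_subset hφt (x := 1) (by simp)]
  simp

theorem HasWeakDeriv.congr_ae {w₁ w₂ v : ℝ → ℝ} (h : HasWeakDeriv w₂ v)
    (hw : ∀ᵐ x ∂(volume.restrict (Ioo (0 : ℝ) 1)), w₁ x = w₂ x) : HasWeakDeriv w₁ v := by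
  intro φ hφ hφs hφt
  rw [← h φ hφ hφs hφt]
  refine integral_congr_ae ?_
  filter_upwards [hw] with x hx
  rw [hx]

theorem ae_hasDerivAt_sub_primitive (hg : IntegrableOn g (Ioo 0 1)) (C : ℝ) :
    ∀ᵐ x ∂(volume.restrict (Ioo (0 : ℝ) 1)),
      HasDerivAt (fun y => C - primitive g y) (-g x) x :=
  (ae_hasDerivAt_primitive hg).mono fun x hx => by simpa using hx.const_sub C

theorem continuous_invFlux_comp {H : ℝ → ℝ} (hH : Continuous H) (hH1 : ∀ x, |H x| < 1) :
    Continuous fun x => invFlux (H x) :=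
  contDiffOn_invFlux.continuousOn.comp_continuous hH fun x => abs_lt.1 (hH1 x)

/-- The inverse of the curvature flux maps `W^{1,1}` functions with values in `(-1,1)` to
`W^{1,1}` functions. -/
theorem hasWeakDeriv_invFlux_sub_primitive (hg : IntegrableOn g (Ioo 0 1))
    (hH : ∀ x, |C - primitive g x| < 1) :
    ∃ w : ℝ → ℝ, IntegrableOn w (Ioo 0 1) ∧
      HasWeakDeriv (fun x => invFlux (C - primitive g x)) w := by
  set H : ℝ → ℝ := fun x => C - primitive g x with hHdef
  have hHc : Continuous H := continuous_const.sub (continuous_primitive hg)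
  have hmem : ∀ x, H x ∈ Ioo (-1 : ℝ) 1 := fun x => abs_lt.1 (hH x)
  refine ⟨fun x => deriv invFlux (H x) * -g x, ?_, ?_⟩
  · have hdc : Continuous fun x => deriv invFlux (H x) :=
      (contDiffOn_invFlux.continuousOn_deriv_of_isOpen isOpen_Ioo le_rfl).comp_continuous hHc hmem
    obtain ⟨K, hK⟩ := isCompact_Icc.exists_bound_of_continuousOn (s := Icc (0 : ℝ) 1)
      hdc.continuousOn
    exact hg.neg.bdd_mul hdc.aestronglyMeasurable
      ((ae_restrict_mem measurableSet_Ioo).mono fun x hx => hK x (Ioo_subset_Icc_self hx))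
  -- `invFlux` is not Lipschitz on all of `(-1,1)`, but it is on a compact interval containing
  -- `H([0,1])`.
  · obtain ⟨α, β, hα, hβ, hsub⟩ := exists_Icc_of_isCompact_subset_Ioo
      ((isCompact_uIcc (a := (0 : ℝ)) (b := 1)).image hHc) (by norm_num : (-1 : ℝ) < 1)
      (image_subset_iff.2 fun x _ => hmem x)
    obtain ⟨K, hK⟩ := (contDiffOn_invFlux.mono
      (Icc_subset_Ioo hα hβ : Icc α β ⊆ Ioo (-1) 1)).exists_lipschitzOnWith one_ne_zero
      (convex_Icc _ _) isCompact_Icc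
    have hHac : AbsolutelyContinuousOnInterval H 0 1 :=
      contDiffOn_const.absolutelyContinuousOnInterval.fun_sub
        (absolutelyContinuousOnInterval_primitive hg)
    refine hasWeakDeriv_of_absolutelyContinuous
      (hK.comp_absolutelyContinuousOnInterval hHac (mapsTo_iff_image_subset.2 hsub)) ?_
    filter_upwards [ae_hasDerivAt_sub_primitive hg C] with x hx
    have hd : HasDerivAt invFlux (deriv invFlux (H x)) (H x) :=
      ((contDiffOn_invFlux.differentiableOn one_ne_zero).differentiableAt
        (isOpen_Ioo.mem_nhds (hmem x))).hasDerivAt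
    exact hd.comp x hx

end Regularity

end PeriodicCurvature

/-! ### Proof of the theorem. -/

open PeriodicCurvature in
/-- A bounded variation solution of the periodic prescribed curvature problem is in
`W^{2,1}(0,1)`, and its representative `U ∈ C¹[0,1]` (with derivative `V`) satisfies the equation
almost everywhere and the periodic boundary conditions. -/
theorem theorem4p5 (f : ℝ → ℝ → ℝ) (u : ℝ → ℝ) (hu : IsPeriodicBVSolution f u)
    (z : ℝ) (hz : z ∈ Ioo (0 : ℝ) 1)
    (hpos : ∀ᵐ x ∂(volume.restrict (Ioo 0 z)), 0 ≤ f x (u x))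
    (hneg : ∀ᵐ x ∂(volume.restrict (Ioo z 1)), f x (u x) ≤ 0)
    (hdecay_z : DecayLeft (fun x => f x (u x)) z ∨ DecayRight (fun x => -f x (u x)) z)
    (hdecay_end : DecayRight (fun x => f x (u x)) 0 ∨ DecayLeft (fun x => -f x (u x)) 1) :
    MemW21 u ∧
    ∃ U V : ℝ → ℝ,
      (∀ᵐ x ∂(volume.restrict (Ioo 0 1)), u x = U x) ∧
      (∀ x ∈ Icc (0 : ℝ) 1, HasDerivWithinAt U (V x) (Icc 0 1) x) ∧
      ContinuousOn V (Icc 0 1) ∧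
      (∀ᵐ x ∂(volume.restrict (Ioo 0 1)),
        HasDerivAt (fun y => V y / √(1 + V y ^ 2)) (-f x (U x)) x) ∧
      U 0 = U 1 ∧ V 0 = V 1 := by
  obtain ⟨hg, ν, u₀, u₁, hν, h0, h1, htest⟩ := hu
  set g : ℝ → ℝ := fun x => f x (u x)
  have hweak : WeakEquation g ν u₀ u₁ := htest
  obtain ⟨C, hflux, hsign⟩ := hweak.exists_flux_eq hg
  have hg0 := hweak.primitive_one_eq_zero
  have hH : ∀ x, |C - primitive g x| < 1 :=
    abs_sub_primitive_lt_one hz hg hg0 (integrable_acDensity ν) hflux hpos hneg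
      hdecay_z hdecay_end
  -- Different traces would give `|C| = 1`, against the strict bound at `x = 0`, where `G = 0`.
  have heq : u₀ = u₁ := by
    by_contra hne
    have hC := hH 0
    rw [primitive_zero, sub_zero, ← abs_neg, ← hsign hne] at hC
    rcases lt_or_gt_of_ne (sub_ne_zero.2 (Ne.symm hne)) with h | h
    · simp [Real.sign_of_neg h] at hC
    · simp [Real.sign_of_pos h] at hC
  have hs := hweak.singPart_eq_zero hν h0 h1 heq hg hflux hH
  set V : ℝ → ℝ := fun x => invFlux (C - primitive g x) with hV
  have hVc : Continuous V :=
    continuous_invFlux_comp (continuous_const.sub (continuous_primitive hg)) hH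
  have haV : ∀ᵐ x ∂(volume.restrict (Ioo (0 : ℝ) 1)), acDensity ν x = V x :=
    hflux.mono fun x hx => by rw [hV]; simp only; rw [← hx, invFlux_flux]
  obtain ⟨c, hc⟩ := hν.exists_ae_eq_integral hs haV
  set U : ℝ → ℝ := fun x => c + ∫ t in (0 : ℝ)..x, V t with hU
  have hUd : ∀ x, HasDerivAt U (V x) x := fun x =>
    (hVc.integral_hasStrictDerivAt 0 x).hasDerivAt.const_add c
  have hUc : Continuous U := continuous_iff_continuousAt.2 fun x => (hUd x).continuousAt
  have hU1 : ContDiff ℝ 1 U := contDiff_one_iff_deriv.2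
    ⟨fun x => (hUd x).differentiableAt, by rwa [funext fun x => (hUd x).deriv]⟩
  obtain ⟨w, hw, hVw⟩ := hasWeakDeriv_invFlux_sub_primitive hg hH
  refine ⟨⟨hν.integrable, V, w, continuous_integrableOn_Ioo hVc 0 1, hw,
    (hasWeakDeriv_of_absolutelyContinuous hU1.contDiffOn.absolutelyContinuousOnInterval
      (.of_forall hUd)).congr_ae hc, hVw⟩, U, V, hc, fun x _ => (hUd x).hasDerivWithinAt,
    hVc.continuousOn, ?_, ?_, ?_⟩
  · filter_upwards [hc, ae_hasDerivAt_sub_primitive hg C] with x hx hd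
    rw [show U x = u x from hx.symm]
    -- The flux of `V` equals `C - G` everywhere, so its derivative is `-g` almost everywhere.
    exact hd.congr_of_eventuallyEq (.of_forall fun y => flux_invFlux (hH y))
  · rw [← h0.eq_of_tendsto hc (hUc.continuousAt.mono_left nhdsWithin_le_nhds),
      ← h1.eq_of_tendsto hc (hUc.continuousAt.mono_left nhdsWithin_le_nhds), heq]
  · simp only [hV, primitive_zero, hg0]
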